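/- Let $d\ge 1$ and let $h=\sum_{\mathbf n\in\mathbb Z^d}h_{\mathbf n}u^{\mathbf n}\in\mathbb Z[u_1^{\pm1},\dots,u_d^{\pm1}]$ be a sandpile polynomial (written $h\in\mathbf P_d$), that is, $2h_{\mathbf 0}>\sum_{\mathbf j}|h_{\mathbf j}|>0$ and $h_{\mathbf j}\le 0$ for all $\mathbf j\ne\mathbf 0$. Put $\gamma_h=h_{\mathbf 0}$ and $\tilde h=\sum_{\mathbf n}h_{\mathbf n}u^{-\mathbf n}$, and write $(a\cdot b)_{\mathbf n}=\sum_{\mathbf j}a_{\mathbf j}b_{\mathbf n-\mathbf j}$, where $h$ is identified with $(h_{\mathbf n})_{\mathbf n\in\mathbb Z^d}$. Let $\mathcal R^{(h)}$ be the set of recurrent configurations, i.e. of all $v\in\{0,\dots,\gamma_h-1\}^{\mathbb Z^d}$ such that every nonempty finite set $E\subset\mathbb Z^d$ contains a site $\mathbf i$ with $v_{\mathbf i}\ge-\sum_{\mathbf j\in E,\ \mathbf j\ne\mathbf i}h_{\mathbf i-\mathbf j}$, with the shift action $(\sigma^{\mathbf m}v)_{\mathbf n}=v_{\mathbf n+\mathbf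 m}$ of $\mathbb Z^d$. With $\mathbb T=\mathbb R/\mathbb Z$ let $$X_{\tilde h}=\Bigl\{x\in\mathbb T^{\mathbb Z^d}:\ \sum_{\mathbf n}\tilde h_{\mathbf n}x_{\mathbf n+\mathbf m}=0\ \text{ for all }\mathbf m\in\mathbb Z^d\Bigr\},$$ and let $\alpha_{\tilde h}$ be the shift action of $\mathbb Z^d$ on $X_{\tilde h}$. Let $w^h$ be the unique element of $\ell^1(\mathbb Z^d,\mathbb R)$ with $h\cdot w^h=\delta_{\mathbf 0}$, and for $v\in\ell^\infty(\mathbb Z^d,\mathbb Z)$ put $\xi_h(v)=w^h\cdot v \pmod 1\in\mathbb T^{\mathbb Z^d}$. Then: 1. $\xi_h(\mathcal R^{(h)})=X_{\tilde h}$. 2. If $v,w\in\mathcal R^{(h)}$ are distinct and $v-w$ has finite support, then $\xi_h(v)\ne\xi_h(w)$. 3. For every $v\in\ell^\infty(\mathbb Z^d,\mathbb Z)$ there is an $m\in\ell^\infty(\mathbb Z^d,\mathbb Z)$ with $v+h\cdot m\in\mathcal R^{(h)}$. Moreover, the topological entropies of the shift $\sigma$ on $\mathcal R^{(h)}$ and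 of $\alpha_{\tilde h}$ on $X_{\tilde h}$ coincide. -/

import Mathlib

open Filter Topology Uniformity

noncomputable section

/-- The ring `ℤ[u₁^{±1}, …, u_d^{±1}]` of Laurent polynomials, as the group ring of `ℤ^d`.
The coefficient of `u^n` in `h` is `h.coeff n`. -/
abbrev LaurentPoly (d : ℕ) : Type := AddMonoidAlgebra ℤ (Fin d → ℤ)

namespace LaurentPoly

variable {d : ℕ}

/-- `h` is lopsided with dominant coefficient `h_m`: `2 h_m > ∑ |h_j| > 0`. -/
def LopsidedAt (h : LaurentPoly d) (m : Fin d → ℤ) : Prop :=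
  (∑ j ∈ h.coeff.support, |h.coeff j|) < 2 * h.coeff m ∧
    0 < ∑ j ∈ h.coeff.support, |h.coeff j|

/-- Sandpile polynomials: lopsided, with dominant coefficient at `0`, and all other
coefficients nonpositive. -/
structure IsSandpile (h : LaurentPoly d) : Prop where
  lopsided : h.LopsidedAt 0
  nonpos : ∀ j, j ≠ 0 → h.coeff j ≤ 0

/-- The dominant coefficient `γ_h = h_0` of a sandpile polynomial. -/
def gamma (h : LaurentPoly d) : ℤ := h.coeff 0

/-- The Laurent polynomial `h̃ = ∑ h_n u^{-n}`. -/
def tilde (h : LaurentPoly d) : LaurentPoly d :=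
  AddMonoidAlgebra.ofCoeff (Finsupp.equivMapDomain (Equiv.neg (Fin d → ℤ)) h.coeff)

theorem coeff_tilde (h : LaurentPoly d) (n : Fin d → ℤ) :
    h.tilde.coeff n = h.coeff (-n) := rfl

/-- The product `(h · v)_n = ∑_j h_j v_{n-j}`, for a configuration `v` with values in any
abelian group. -/
def act {A : Type*} [AddCommGroup A] (h : LaurentPoly d) (v : (Fin d → ℤ) → A) :
    (Fin d → ℤ) → A :=
  fun n => ∑ j ∈ h.coeff.support, h.coeff j • v (n - j)

/-! ### The abelian sandpile model -/

/-- The toppling matrix `Δ_{ij} = h_{i-j}` on a finite set `E` of sites: the toppling of the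
site `j` replaces a configuration `v` by `i ↦ v_i - Δ_{ij}`. -/
def topplingMatrix (h : LaurentPoly d) (E : Finset (Fin d → ℤ)) : Matrix E E ℤ :=
  Matrix.of fun i j => h.coeff (i.1 - j.1)

/-- `N_E(i) = -∑_{j ∈ E, j ≠ i} Δ_{ij}`: the number of grains that the site `i` receives when
every other site of `E` topples once. -/
def inflow (h : LaurentPoly d) (E : Finset (Fin d → ℤ)) (i : E) : ℤ :=
  -∑ j ∈ Finset.univ.erase i, h.topplingMatrix E i j

/-- The stable configurations `{0, …, γ_h - 1}^E` on `E`. -/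
def stableOn (h : LaurentPoly d) (E : Finset (Fin d → ℤ)) : Set (E → ℤ) :=
  {v | ∀ i, 0 ≤ v i ∧ v i < h.gamma}

/-- The stable configurations on `E` with `v_i ≥ N_E(i)` for at least one site `i ∈ E`. -/
def allowedOn (h : LaurentPoly d) (E : Finset (Fin d → ℤ)) : Set (E → ℤ) :=
  {v | v ∈ h.stableOn E ∧ ∃ i, h.inflow E i ≤ v i}

/-- The abelian sandpile model `R^{(h)}` in infinite volume: all configurations whose
restriction to every nonempty finite set `E` of sites is allowed. -/
def recurrent (h : LaurentPoly d) : Set ((Fin d → ℤ) → ℤ) :=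
  {v | ∀ E : Finset (Fin d → ℤ), E.Nonempty → (fun i : E => v i) ∈ h.allowedOn E}

/-! ### The algebraic model -/

/-- `X_h`: the points `x` of `𝕋^{ℤ^d}` with `∑_n h_n x_{n+m} = 0` for all `m`. -/
def algModel (h : LaurentPoly d) : Set ((Fin d → ℤ) → UnitAddCircle) :=
  {x | ∀ m, ∑ n ∈ h.coeff.support, h.coeff n • x (n + m) = 0}

/-! ### The homoclinic point and the map `ξ_h` -/

theorem IsSandpile.gamma_pos {h : LaurentPoly d} (hh : h.IsSandpile) : 0 < h.gamma := by
  have h1 := hh.lopsided.1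
  have h2 := hh.lopsided.2
  unfold gamma
  linarith

theorem IsSandpile.zero_mem {h : LaurentPoly d} (hh : h.IsSandpile) :
    (0 : Fin d → ℤ) ∈ h.coeff.support :=
  Finsupp.mem_support_iff.2 hh.gamma_pos.ne'

theorem IsSandpile.sum_lt {h : LaurentPoly d} (hh : h.IsSandpile) :
    ∑ j ∈ h.coeff.support.erase 0, |h.coeff j| < h.gamma := by
  have h1 := hh.lopsided.1
  rw [← Finset.add_sum_erase _ _ hh.zero_mem] at h1
  have h2 := le_abs_self (h.coeff 0)
  unfold gamma
  linarith

theorem IsSandpile.act_eq {h : LaurentPoly d} (hh : h.IsSandpile) (w : (Fin d → ℤ) → ℝ)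
    (n : Fin d → ℤ) :
    h.act w n = h.gamma * w n + ∑ j ∈ h.coeff.support.erase 0, (h.coeff j : ℝ) * w (n - j) := by
  unfold act
  rw [← Finset.add_sum_erase _ _ hh.zero_mem]
  simp [gamma, zsmul_eq_mul]

/-- A summable solution of `h · z = 0` vanishes. -/
theorem IsSandpile.eq_zero_of_act_eq_zero {h : LaurentPoly d} (hh : h.IsSandpile)
    {z : (Fin d → ℤ) → ℝ} (hz : Summable z) (h0 : h.act z = 0) : z = 0 := by
  have hlt : ∑ j ∈ h.coeff.support.erase 0, |(h.coeff j : ℝ)| < h.gamma := by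
    exact_mod_cast hh.sum_lt
  have hγ : (0 : ℝ) < h.gamma := by exact_mod_cast hh.gamma_pos
  have ha : Summable fun n => |z n| := hz.abs
  have hS : HasSum (fun n => ∑ j ∈ h.coeff.support.erase 0, |(h.coeff j : ℝ)| * |z (n - j)|)
      (∑ j ∈ h.coeff.support.erase 0, |(h.coeff j : ℝ)| * ∑' n, |z n|) :=
    hasSum_sum fun j _ => ((Equiv.subRight j).hasSum_iff.2 ha.hasSum).mul_left _
  have hle : (h.gamma : ℝ) * ∑' n, |z n|
      ≤ ∑ j ∈ h.coeff.support.erase 0, |(h.coeff j : ℝ)| * ∑' n, |z n| := by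
    refine hasSum_le (fun n => ?_) (ha.hasSum.mul_left (h.gamma : ℝ)) hS
    have hn := congrFun h0 n
    rw [hh.act_eq, Pi.zero_apply] at hn
    calc (h.gamma : ℝ) * |z n| = |(h.gamma : ℝ) * z n| := by rw [abs_mul, abs_of_pos hγ]
      _ = |∑ j ∈ h.coeff.support.erase 0, (h.coeff j : ℝ) * z (n - j)| := by
          rw [eq_neg_of_add_eq_zero_left hn, abs_neg]
      _ ≤ _ := by
          refine (Finset.abs_sum_le_sum_abs _ _).trans (le_of_eq ?_)
          exact Finset.sum_congr rfl fun j _ => abs_mul _ _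
  rw [← Finset.sum_mul] at hle
  have hT : ∑' n, |z n| = 0 := by
    have h1 : 0 ≤ ∑' n, |z n| := tsum_nonneg fun n => abs_nonneg _
    nlinarith
  have := (hasSum_zero_iff_of_nonneg fun n => abs_nonneg (z n)).1 (hT ▸ ha.hasSum)
  funext n
  exact abs_eq_zero.1 (congrFun this n)

/-- The terms of the Neumann series of `γ_h⁻¹ h`. -/
def neumann (h : LaurentPoly d) : ℕ → (Fin d → ℤ) → ℝ
  | 0 => Pi.single 0 1
  | k + 1 => fun n => ∑ j ∈ h.coeff.support.erase 0,
      (|(h.coeff j : ℝ)| / h.gamma) * neumann h k (n - j)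

/-- For a sandpile polynomial the equation `h · w = δ_0` has exactly one solution
`w ∈ ℓ¹(ℤ^d, ℝ)`. -/
theorem IsSandpile.existsUnique_homoclinic {h : LaurentPoly d} (hh : h.IsSandpile) :
    ∃! w : (Fin d → ℤ) → ℝ, Summable w ∧ h.act w = Pi.single 0 1 := by
  have hγ : (0 : ℝ) < h.gamma := by exact_mod_cast hh.gamma_pos
  set S := h.coeff.support.erase 0 with hS
  set r : ℝ := ∑ j ∈ S, |(h.coeff j : ℝ)| / h.gamma with hr
  have hr0 : 0 ≤ r := Finset.sum_nonneg fun j _ => by positivity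
  have hsum : ∑ j ∈ S, |(h.coeff j : ℝ)| < h.gamma := by exact_mod_cast hh.sum_lt
  have hr1 : r < 1 := by
    rw [hr, ← Finset.sum_div, div_lt_one hγ]
    exact hsum
  have habs : ∀ j ∈ S, (h.coeff j : ℝ) = -|(h.coeff j : ℝ)| := fun j hj => by
    have : (h.coeff j : ℝ) ≤ 0 := by exact_mod_cast hh.nonpos j (Finset.ne_of_mem_erase hj)
    rw [abs_of_nonpos this, neg_neg]
  have hnn : ∀ k n, 0 ≤ h.neumann k n := by
    intro k
    induction k with
    | zero =>
      intro n
      by_cases hn : n = 0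
      · subst hn; simp [neumann]
      · simp [neumann, hn]
    | succ k ih =>
      intro n
      exact Finset.sum_nonneg fun j _ => mul_nonneg (by positivity) (ih _)
  have hhas : ∀ k, HasSum (h.neumann k) (r ^ k) := by
    intro k
    induction k with
    | zero =>
      simpa [neumann] using hasSum_pi_single (0 : Fin d → ℤ) (1 : ℝ)
    | succ k ih =>
      rw [pow_succ', hr, Finset.sum_mul]
      refine hasSum_sum fun j _ => ?_
      exact ((Equiv.subRight j).hasSum_iff.2 ih).mul_left _
  have hprod : Summable fun p : ℕ × (Fin d → ℤ) => h.neumann p.1 p.2 := by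
    refine (summable_prod_of_nonneg fun p => hnn p.1 p.2).2 ⟨fun k => (hhas k).summable, ?_⟩
    simp only [(hhas _).tsum_eq]
    exact summable_geometric_of_lt_one hr0 hr1
  have hcol : ∀ n, Summable fun k => h.neumann k n := fun n => hprod.prod_symm.prod_factor n
  have hex : ∃ w : (Fin d → ℤ) → ℝ, Summable w ∧ h.act w = Pi.single 0 1 := by
    refine ⟨fun n => (h.gamma : ℝ)⁻¹ * ∑' k, h.neumann k n, hprod.prod_symm.prod.mul_left _, ?_⟩
    funext n
    rw [hh.act_eq, mul_inv_cancel_left₀ hγ.ne', (hcol n).tsum_eq_zero_add]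
    have : ∑' k, h.neumann (k + 1) n
        = ∑ j ∈ S, (|(h.coeff j : ℝ)| / h.gamma) * ∑' k, h.neumann k (n - j) := by
      simp only [neumann]
      rw [Summable.tsum_finsetSum fun j _ => (hcol (n - j)).mul_left _]
      exact Finset.sum_congr rfl fun j _ => tsum_mul_left
    rw [this, add_assoc, ← Finset.sum_add_distrib, Finset.sum_eq_zero, add_zero]
    · rfl
    · intro j hj
      rw [habs j hj, abs_neg, abs_abs]
      ring
  obtain ⟨w, hw, hwe⟩ := hex
  refine ⟨w, ⟨hw, hwe⟩, fun w' ⟨hw', hwe'⟩ => ?_⟩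
  refine sub_eq_zero.1 (hh.eq_zero_of_act_eq_zero (hw'.sub hw) ?_)
  have : h.act (w' - w) = h.act w' - h.act w := by
    funext n
    simp [act, mul_sub, Finset.sum_sub_distrib]
  rw [this, hwe, hwe', sub_self]

open Classical in
/-- The homoclinic point `w^h`: the unique `w ∈ ℓ¹(ℤ^d, ℝ)` with `h · w = δ_0` (and `0` if there
is no such `w`, which does not happen for sandpile polynomials). -/
def homoclinic (h : LaurentPoly d) : (Fin d → ℤ) → ℝ :=
  if H : ∃! w : (Fin d → ℤ) → ℝ, Summable w ∧ h.act w = Pi.single 0 1 then H.choose else 0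

theorem IsSandpile.homoclinic_spec {h : LaurentPoly d} (hh : h.IsSandpile) :
    Summable h.homoclinic ∧ h.act h.homoclinic = Pi.single 0 1 := by
  have H := hh.existsUnique_homoclinic
  rw [homoclinic, dif_pos H]
  exact H.choose_spec.1

/-- The elements of `ℓ^∞(ℤ^d, ℤ)`: bounded integer configurations. -/
def IsBoundedConfig (v : (Fin d → ℤ) → ℤ) : Prop :=
  ∃ C : ℤ, ∀ n, |v n| ≤ C

/-- `ξ̄_h(v) = w^h · v`, that is `ξ̄_h(v)_n = ∑_j w^h_j v_{n-j}`; for a sandpile polynomial `h` and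
a bounded configuration `v` the series converges absolutely. -/
def xiBar (h : LaurentPoly d) (v : (Fin d → ℤ) → ℤ) : (Fin d → ℤ) → ℝ :=
  fun n => ∑' j, h.homoclinic j * (v (n - j) : ℝ)

theorem IsSandpile.summable_xiBar {h : LaurentPoly d} (hh : h.IsSandpile)
    {v : (Fin d → ℤ) → ℤ} (hv : IsBoundedConfig v) (n : Fin d → ℤ) :
    Summable fun j => h.homoclinic j * (v (n - j) : ℝ) := by
  obtain ⟨C, hC⟩ := hv
  refine Summable.of_norm_bounded (hh.homoclinic_spec.1.abs.mul_right (C : ℝ)) fun j => ?_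
  rw [Real.norm_eq_abs, abs_mul]
  have : |(v (n - j) : ℝ)| ≤ C := by exact_mod_cast hC (n - j)
  gcongr

/-- `ξ_h(v) = ξ̄_h(v) mod 1`. -/
def xi (h : LaurentPoly d) (v : (Fin d → ℤ) → ℤ) : (Fin d → ℤ) → UnitAddCircle :=
  fun n => (h.xiBar v n : UnitAddCircle)

end LaurentPoly

/-! ### Shift actions and topological entropy -/

/-- The shift `(σ^m v)_n = v_{n+m}`. -/
def latticeShift {d : ℕ} {A : Type*} (m : Fin d → ℤ) (v : (Fin d → ℤ) → A) :
    (Fin d → ℤ) → A :=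
  fun n => v (n + m)

/-- A finite set `s` is `(Q, U)`-separated for the action `T` of `ℤ^d`: any two distinct points
of `s` are moved `U`-apart by some `T^k` with `k ∈ Q`. -/
def IsSeparatedFor {d : ℕ} {Y : Type*} (T : (Fin d → ℤ) → Y → Y) (Q : Finset (Fin d → ℤ))
    (U : Set (Y × Y)) (s : Finset Y) : Prop :=
  ∀ x ∈ s, ∀ y ∈ s, x ≠ y → ∃ k ∈ Q, (T k x, T k y) ∉ U

/-- The maximal cardinality of a `(Q, U)`-separated set. -/
def maxSeparated {d : ℕ} {Y : Type*} (T : (Fin d → ℤ) → Y → Y) (Q : Finset (Fin d → ℤ))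
    (U : Set (Y × Y)) : ℕ∞ :=
  ⨆ (s : Finset Y) (_ : IsSeparatedFor T Q U s), (s.card : ℕ∞)

/-- The cube `Q_L = {-L, …, L}^d`. -/
def cube (d L : ℕ) : Finset (Fin d → ℤ) :=
  Finset.Icc (fun _ => -(L : ℤ)) (fun _ => (L : ℤ))

/-- The topological entropy of a continuous action `T` of `ℤ^d` on a compact uniform space `Y`:
the supremum over the entourages `U` of the exponential growth rates, along the cubes `Q_L` and
relative to `|Q_L|`, of the maximal cardinality of a `(Q_L, U)`-separated set. -/
def latticeEntropy {d : ℕ} {Y : Type*} [UniformSpace Y] (T : (Fin d → ℤ) → Y → Y) : EReal :=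
  ⨆ U ∈ 𝓤 Y, limsup (fun L : ℕ =>
    ENNReal.log (maxSeparated T (cube d L) U : ENNReal) / ((cube d L).card : EReal)) atTop

namespace LaurentPoly

variable {d : ℕ}

theorem mapsTo_shift_recurrent (h : LaurentPoly d) (m : Fin d → ℤ) :
    Set.MapsTo (latticeShift m) h.recurrent h.recurrent := by
  intro v hv E hE
  obtain ⟨hs, ⟨i, hi⟩, hle⟩ := hv (E.map (Equiv.addRight m).toEmbedding) (hE.map)
  refine ⟨fun i => ?_, ?_⟩
  · exact hs ⟨i.1 + m, by simp⟩
  · rw [Finset.mem_map] at hi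
    obtain ⟨i, hiE, rfl⟩ := hi
    refine ⟨⟨i, hiE⟩, le_trans (le_of_eq ?_) hle⟩
    unfold inflow topplingMatrix
    congr 1
    refine Finset.sum_bij (fun j _ => ⟨j.1 + m, by simp⟩) ?_ ?_ ?_ ?_
    · intro j hj
      refine Finset.mem_erase.2 ⟨fun h' => (Finset.mem_erase.1 hj).1 ?_, Finset.mem_univ _⟩
      exact Subtype.ext (add_right_cancel (congrArg Subtype.val h'))
    · intro a _ b _ hab
      exact Subtype.ext (add_right_cancel (congrArg Subtype.val hab))
    · rintro ⟨b, hb⟩ hb'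
      rw [Finset.mem_map] at hb
      obtain ⟨a, haE, rfl⟩ := hb
      refine ⟨⟨a, haE⟩, ?_, rfl⟩
      refine Finset.mem_erase.2 ⟨fun h' => (Finset.mem_erase.1 hb').1 ?_, Finset.mem_univ _⟩
      exact Subtype.ext (congrArg (fun z : E => z.1 + m) h')
    · intro j _
      change h.coeff (i - j.1) = h.coeff (i + m - (j.1 + m))
      rw [add_sub_add_right_eq_sub]

theorem mapsTo_shift_algModel (h : LaurentPoly d) (m : Fin d → ℤ) :
    Set.MapsTo (latticeShift m) h.algModel h.algModel := by
  intro x hx k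
  simpa [latticeShift, add_assoc] using hx (k + m)

/-- The shift action `σ` of `ℤ^d` on `R^{(h)}`, which carries the product topology. -/
def recurrentShift (h : LaurentPoly d) (m : Fin d → ℤ) : h.recurrent → h.recurrent :=
  (h.mapsTo_shift_recurrent m).restrict

/-- The shift action `α_h` of `ℤ^d` on `X_h`, which carries the product topology. -/
def algShift (h : LaurentPoly d) (m : Fin d → ℤ) : h.algModel → h.algModel :=
  (h.mapsTo_shift_algModel m).restrict

end LaurentPoly

end

noncomputable section

namespace LaurentPoly

variable {d : ℕ}

/-! ### The action of a Laurent polynomial -/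

/-! Adding `h · m` to a configuration amounts to toppling each site `-m_n` times. It changes `ξ̄_h`
by the integers `m_n`, so `ξ_h` is constant on toppling classes.

Since off-diagonal coefficients are nonpositive and `h(1) > 0`, a maximum principle holds
(`act_le_act`). It makes `{f : v + h · f ≤ γ_h - 1}` closed under suprema of bounded families. The
largest bounded `f` in this set yields a recurrent configuration, because a forbidden finite set `E`
would allow `f + 1_E` (`exists_add_act_mem_recurrent`). Lifting a point of `X_{h̃}` to reals gives a
bounded integer `v`, and surjectivity follows.

If `v, w` are recurrent with finite difference and `ξ_h(v) = ξ_h(w)`, then `v - w = h · m` with `m`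
integral and summable, hence finitely supported. Looking at the set where `±m` is maximal gives `m =
0` (`nonpos_of_sub_eq_act`).

For the entropies, `ξ_h` is an equivariant surjection, which gives one inequality. Conversely,
recurrent configurations can be made maximal outside a cube without leaving `R^{(h)}`. Such
truncations differ finitely, and their images are uniformly separated on a slightly larger cube
(`exists_separation`), at no cost in growth rate. -/

theorem act_add {A : Type*} [AddCommGroup A] (h : LaurentPoly d) (f g : (Fin d → ℤ) → A) :
    h.act (f + g) = h.act f + h.act g := by
  funext n
  simp [act, Finset.sum_add_distrib]

theorem act_sub {A : Type*} [AddCommGroup A] (h : LaurentPoly d) (f g : (Fin d → ℤ) → A) :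
    h.act (f - g) = h.act f - h.act g := by
  funext n
  simp [act, smul_sub, Finset.sum_sub_distrib]

theorem act_map {A B : Type*} [AddCommGroup A] [AddCommGroup B] (h : LaurentPoly d)
    (φ : A →+ B) (f : (Fin d → ℤ) → A) (n : Fin d → ℤ) :
    h.act (fun k => φ (f k)) n = φ (h.act f n) := by
  simp [act, map_sum, map_zsmul]

theorem act_intCast (h : LaurentPoly d) (f : (Fin d → ℤ) → ℤ) (n : Fin d → ℤ) :
    h.act (fun k => (f k : ℝ)) n = (h.act f n : ℤ) :=
  h.act_map (Int.castAddHom ℝ) f n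

/-- The sum `h(1)` of the coefficients. -/
def mass (h : LaurentPoly d) : ℤ := ∑ j ∈ h.coeff.support, h.coeff j

theorem act_const (h : LaurentPoly d) (c : ℤ) (n : Fin d → ℤ) :
    h.act (fun _ => c) n = h.mass * c := by
  simp [act, mass, Finset.sum_mul]

theorem IsSandpile.mass_pos {h : LaurentPoly d} (hh : h.IsSandpile) : 0 < h.mass := by
  have h1 := hh.sum_lt
  unfold mass
  rw [← Finset.add_sum_erase _ _ hh.zero_mem]
  have h2 : -∑ j ∈ h.coeff.support.erase 0, |h.coeff j|
      ≤ ∑ j ∈ h.coeff.support.erase 0, h.coeff j := by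
    rw [← Finset.sum_neg_distrib]
    exact Finset.sum_le_sum fun j _ => neg_abs_le _
  unfold gamma at h1
  linarith

/-- Maximum principle: with the value at `n` fixed, only the nonpositive coefficients see the
change. -/
theorem IsSandpile.act_le_act {h : LaurentPoly d} (hh : h.IsSandpile) {f g : (Fin d → ℤ) → ℤ}
    (hfg : ∀ n, f n ≤ g n) {n : Fin d → ℤ} (hn : f n = g n) : h.act g n ≤ h.act f n := by
  refine Finset.sum_le_sum fun j _ => ?_
  by_cases hj : j = 0
  · subst hj
    simp [hn]
  · simpa only [smul_eq_mul] using mul_le_mul_of_nonpos_left (hfg (n - j)) (hh.nonpos j hj)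

/-- Integrality gives `f ≤ (M - 1) + 1_E` with equality on `E`, and the constant `M - 1 ≥ 0`
contributes `h(1)(M - 1) ≥ 0`. -/
theorem IsSandpile.act_indicator_le {h : LaurentPoly d} (hh : h.IsSandpile)
    {f : (Fin d → ℤ) → ℤ} {M : ℤ} (hM : 1 ≤ M) (hf : ∀ n, f n ≤ M) {E : Set (Fin d → ℤ)}
    (hE : ∀ n, n ∈ E ↔ f n = M) {n : Fin d → ℤ} (hn : n ∈ E) :
    h.act (E.indicator 1) n ≤ h.act f n := by
  classical
  have h1 : h.act ((fun _ => M - 1) + E.indicator 1) n ≤ h.act f n := by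
    refine hh.act_le_act (fun k => ?_) ?_
    · by_cases hk : k ∈ E
      · simp [hk, hf k]
      · have := lt_of_le_of_ne (hf k) fun h' => hk ((hE k).2 h')
        simp only [Pi.add_apply, Set.indicator_of_notMem hk]
        linarith
    · simp [hn, (hE n).1 hn]
  rw [act_add, Pi.add_apply, act_const] at h1
  nlinarith [hh.mass_pos]

theorem act_indicator (h : LaurentPoly d) (E : Finset (Fin d → ℤ)) (n : Fin d → ℤ) :
    h.act ((E : Set (Fin d → ℤ)).indicator 1) n = ∑ j ∈ E, h.coeff (n - j) := by
  classical
  unfold act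
  refine Finset.sum_bij_ne_zero (fun j _ _ => n - j) ?_ ?_ ?_ ?_
  · intro j _ hj
    by_contra hjE
    exact hj (by simp [hjE])
  · intro a _ _ b _ _ hab
    exact sub_right_injective hab
  · intro b hb hb0
    exact ⟨n - b, Finsupp.mem_support_iff.2 hb0, by simpa [hb] using hb0, sub_sub_cancel _ _⟩
  · intro j _ hj
    have hjE : n - j ∈ E := by
      by_contra hjE
      exact hj (by simp [hjE])
    simp [hjE]

/-- Restates the recurrence condition usefully: adding `h · 1_E` must push some site of `E` to
height at least `γ_h`. -/
theorem inflow_eq (h : LaurentPoly d) (E : Finset (Fin d → ℤ)) (i : E) :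
    h.inflow E i = h.gamma - h.act ((E : Set (Fin d → ℤ)).indicator 1) i := by
  classical
  rw [act_indicator, ← Finset.sum_coe_sort E, ← Finset.add_sum_erase _ _ (Finset.mem_univ i)]
  simp [inflow, topplingMatrix, gamma]

theorem mem_recurrent_iff (h : LaurentPoly d) (v : (Fin d → ℤ) → ℤ) :
    v ∈ h.recurrent ↔ (∀ n, 0 ≤ v n ∧ v n < h.gamma) ∧
      ∀ E : Finset (Fin d → ℤ), E.Nonempty →
        ∃ i ∈ E, h.gamma - h.act ((E : Set (Fin d → ℤ)).indicator 1) i ≤ v i := by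
  constructor
  · intro hv
    refine ⟨fun n => (hv {n} (Finset.singleton_nonempty n)).1 ⟨n, by simp⟩, fun E hE => ?_⟩
    obtain ⟨-, i, hi⟩ := hv E hE
    exact ⟨i, i.2, by rwa [inflow_eq] at hi⟩
  · rintro ⟨h1, h2⟩ E hE
    obtain ⟨i, hiE, hi⟩ := h2 E hE
    exact ⟨fun i => h1 i, ⟨i, hiE⟩, by rwa [inflow_eq]⟩

/-! ### Reduction to recurrent configurations -/

/-- A bounded integer function attains its maximum. Comparing there with the constant function
bounds `h(1) · max f` by `C`, and `h(1) ≥ 1`. -/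
theorem IsSandpile.le_of_act_le {h : LaurentPoly d} (hh : h.IsSandpile) {f : (Fin d → ℤ) → ℤ}
    (hf : IsBoundedConfig f) {C : ℤ} (hC : 0 ≤ C) (hfC : ∀ n, h.act f n ≤ C) (n : Fin d → ℤ) :
    f n ≤ C := by
  obtain ⟨B, hB⟩ := hf
  have hbdd : BddAbove (Set.range f) := ⟨B, by rintro _ ⟨k, rfl⟩; exact (abs_le.1 (hB k)).2⟩
  obtain ⟨i, hi⟩ := Int.csSup_mem (Set.range_nonempty f) hbdd
  have hle : ∀ k, f k ≤ f i := fun k => hi ▸ le_csSup hbdd ⟨k, rfl⟩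
  have h1 : h.act (fun _ => f i) i ≤ h.act f i := hh.act_le_act hle rfl
  rw [act_const] at h1
  have h2 := hh.mass_pos
  have h3 := hfC i
  refine (hle n).trans ?_
  by_contra! h4
  nlinarith

theorem IsSandpile.exists_add_act_mem_recurrent {h : LaurentPoly d} (hh : h.IsSandpile)
    {v : (Fin d → ℤ) → ℤ} (hv : IsBoundedConfig v) :
    ∃ m, IsBoundedConfig m ∧ v + h.act m ∈ h.recurrent := by
  classical
  obtain ⟨C, hC⟩ := hv
  have hγ := hh.gamma_pos
  have hC0 : 0 ≤ C := (abs_nonneg _).trans (hC 0)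
  set F : Set ((Fin d → ℤ) → ℤ) :=
    {f | IsBoundedConfig f ∧ ∀ n, h.act f n ≤ h.gamma - 1 - v n} with hF
  have hupper : ∀ f ∈ F, ∀ n, f n ≤ h.gamma + C := fun f hf n =>
    hh.le_of_act_le hf.1 (by linarith) (fun k => (hf.2 k).trans
      (by linarith [(abs_le.1 (hC k)).1])) n
  have hconst : (fun _ => -C) ∈ F := by
    refine ⟨⟨C, fun _ => by simp [abs_of_nonneg hC0]⟩, fun n => ?_⟩
    rw [act_const]
    have := (abs_le.1 (hC n)).2
    nlinarith [hh.mass_pos]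
  have hbdd : ∀ n, BddAbove ((fun f : (Fin d → ℤ) → ℤ => f n) '' F) := fun n =>
    ⟨h.gamma + C, by rintro _ ⟨f, hf, rfl⟩; exact hupper f hf n⟩
  -- The pointwise supremum stays in `F`: it is attained at each `n` by some `f ∈ F`, and raising
  -- the other values only lowers `h · f` at `n`.
  set m : (Fin d → ℤ) → ℤ := fun n => sSup ((fun f : (Fin d → ℤ) → ℤ => f n) '' F) with hm
  have hle : ∀ f ∈ F, ∀ n, f n ≤ m n := fun f hf n => le_csSup (hbdd n) ⟨f, hf, rfl⟩
  have hmem : ∀ n, ∃ f ∈ F, f n = m n := fun n =>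
    Int.csSup_mem (Set.Nonempty.image _ ⟨_, hconst⟩) (hbdd n)
  have hmF : m ∈ F := by
    refine ⟨⟨h.gamma + C, fun n => abs_le.2 ⟨?_, ?_⟩⟩, fun n => ?_⟩
    · exact le_trans (by linarith) (hle _ hconst n)
    · obtain ⟨f, hf, hfn⟩ := hmem n
      exact hfn ▸ hupper f hf n
    · obtain ⟨f, hf, hfn⟩ := hmem n
      exact (hh.act_le_act (hle f hf) hfn).trans (hf.2 n)
  have hfire : ∀ E : Finset (Fin d → ℤ), E.Nonempty → ∃ i ∈ E,
      h.gamma - h.act ((E : Set (Fin d → ℤ)).indicator 1) i ≤ (v + h.act m) i := by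
    intro E hE
    by_contra! hcon
    have hmem' : m + (E : Set (Fin d → ℤ)).indicator 1 ∈ F := by
      refine ⟨?_, fun n => ?_⟩
      · obtain ⟨B, hB⟩ := hmF.1
        refine ⟨B + 1, fun n => (abs_add_le _ _).trans (add_le_add (hB n) ?_)⟩
        by_cases hn : n ∈ E <;> simp [hn]
      · rw [act_add, Pi.add_apply]
        by_cases hn : n ∈ E
        · have := hcon n hn
          rw [Pi.add_apply] at this
          linarith
        · have h1 : h.act ((E : Set (Fin d → ℤ)).indicator 1) n ≤ h.act (fun _ => (0 : ℤ)) n :=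
            hh.act_le_act (fun k => by by_cases hk : k ∈ E <;> simp [hk]) (by simp [hn])
          rw [act_const] at h1
          linarith [hmF.2 n]
    obtain ⟨i, hi⟩ := hE
    have := hle _ hmem' i
    simp [hi] at this
  refine ⟨m, hmF.1, (h.mem_recurrent_iff _).2 ⟨fun n => ⟨?_, ?_⟩, hfire⟩⟩
  -- For a singleton `E` the threshold is `γ_h - h_0 = 0`, which is exactly nonnegativity.
  · obtain ⟨i, hi, hin⟩ := hfire {n} (Finset.singleton_nonempty n)
    rw [Finset.mem_singleton] at hi
    subst hi
    rw [act_indicator] at hin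
    simpa [gamma] using hin
  · have := hmF.2 n
    rw [Pi.add_apply]
    linarith

theorem isBoundedConfig_of_mem_recurrent {h : LaurentPoly d} {v : (Fin d → ℤ) → ℤ}
    (hv : v ∈ h.recurrent) : IsBoundedConfig v :=
  ⟨h.gamma, fun n => by
    obtain ⟨h0, h1⟩ := ((h.mem_recurrent_iff v).1 hv).1 n
    rw [abs_of_nonneg h0]
    exact h1.le⟩

/-- If two recurrent configurations differ by `h · m` with `m` finitely supported, then `m ≤ 0`. -/
theorem IsSandpile.nonpos_of_sub_eq_act {h : LaurentPoly d} (hh : h.IsSandpile)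
    {v w m : (Fin d → ℤ) → ℤ} (hv : v ∈ h.recurrent) (hw : w ∈ h.recurrent)
    (hm : (Function.support m).Finite) (hvw : w - v = h.act m) (n : Fin d → ℤ) : m n ≤ 0 := by
  classical
  by_contra! hn
  obtain ⟨i, hi, hmax⟩ := hm.toFinset.exists_max_image m ⟨n, by simpa using hn.ne'⟩
  have hpos : 1 ≤ m i := by
    have := hmax n (by simpa using hn.ne')
    linarith
  have hle : ∀ k, m k ≤ m i := fun k => by
    by_cases hk : m k = 0
    · linarith
    · exact hmax k (by simpa using hk)
  -- On the set where `m` is maximal, `h · m ≥ h · 1_E`. Recurrence of `v` then forces `w_k ≥ γ_h`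
  -- at some `k ∈ E`.
  set E := hm.toFinset.filter fun k => m k = m i with hE
  have hEmem : ∀ k, k ∈ (E : Set (Fin d → ℤ)) ↔ m k = m i := fun k => by
    simp only [hE, Finset.coe_filter, Set.Finite.mem_toFinset, Function.mem_support,
      Set.mem_ofPred_eq, and_iff_right_iff_imp]
    intro h'
    linarith
  obtain ⟨k, hkE, hk⟩ := ((h.mem_recurrent_iff v).1 hv).2 E ⟨i, (hEmem i).2 rfl⟩
  have h1 := hh.act_indicator_le hpos hle hEmem hkE
  have h2 := congrFun hvw k
  rw [Pi.sub_apply] at h2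
  linarith [(((h.mem_recurrent_iff w).1 hw).1 k).2]

/-! ### Convolution with the homoclinic point -/

/-- The convolution `w^h · f`. -/
def conv (h : LaurentPoly d) (f : (Fin d → ℤ) → ℝ) (n : Fin d → ℤ) : ℝ :=
  ∑' j, h.homoclinic j * f (n - j)

theorem IsSandpile.summable_conv {h : LaurentPoly d} (hh : h.IsSandpile)
    {f : (Fin d → ℤ) → ℝ} {C : ℝ} (hf : ∀ n, |f n| ≤ C) (n : Fin d → ℤ) :
    Summable fun j => h.homoclinic j * f (n - j) := by
  refine Summable.of_norm_bounded (hh.homoclinic_spec.1.abs.mul_right C) fun j => ?_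
  rw [Real.norm_eq_abs, abs_mul]
  have := hf (n - j)
  gcongr

theorem IsSandpile.act_conv {h : LaurentPoly d} (hh : h.IsSandpile)
    {f : (Fin d → ℤ) → ℝ} {C : ℝ} (hf : ∀ n, |f n| ≤ C) : h.act (h.conv f) = f := by
  funext n
  have key : ∀ k, HasSum (fun l => h.coeff k • (h.homoclinic (l - k) * f (n - l)))
      (h.coeff k • h.conv f (n - k)) := fun k => by
    have h1 := (hh.summable_conv hf (n - k)).hasSum
    rw [← (Equiv.subRight k).hasSum_iff] at h1
    simpa [Function.comp_def, conv, sub_sub] using h1.mul_left (h.coeff k : ℝ)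
  have h2 : HasSum (fun l => h.act h.homoclinic l * f (n - l)) (h.act (h.conv f) n) := by
    refine (hasSum_sum fun k _ => key k).congr_fun fun l => ?_
    simp [act, Finset.sum_mul, mul_assoc]
  rw [hh.homoclinic_spec.2] at h2
  refine h2.unique ?_
  have := hasSum_single (f := fun l => (Pi.single 0 1 : (Fin d → ℤ) → ℝ) l * f (n - l)) 0
    fun l hl => by simp [hl]
  simpa using this

theorem IsSandpile.conv_act {h : LaurentPoly d} (hh : h.IsSandpile)
    {f : (Fin d → ℤ) → ℝ} {C : ℝ} (hf : ∀ n, |f n| ≤ C) : h.conv (h.act f) = f := by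
  conv_rhs => rw [← hh.act_conv hf]
  funext n
  have key : ∀ k, HasSum (fun j => h.coeff k • (h.homoclinic j * f (n - k - j)))
      (h.coeff k • h.conv f (n - k)) := fun k => by
    simpa [conv] using (hh.summable_conv hf (n - k)).hasSum.mul_left (h.coeff k : ℝ)
  refine ((hasSum_sum fun k _ => key k).congr_fun fun j => ?_).tsum_eq
  simp only [act, Finset.mul_sum, zsmul_eq_mul]
  refine Finset.sum_congr rfl fun k _ => ?_
  rw [sub_right_comm]
  ring

theorem IsBoundedConfig.exists_abs_le {v : (Fin d → ℤ) → ℤ} (hv : IsBoundedConfig v) :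
    ∃ C : ℝ, ∀ n, |(v n : ℝ)| ≤ C := by
  obtain ⟨C, hC⟩ := hv
  exact ⟨C, fun n => by exact_mod_cast hC n⟩

theorem IsBoundedConfig.sub {v w : (Fin d → ℤ) → ℤ} (hv : IsBoundedConfig v)
    (hw : IsBoundedConfig w) : IsBoundedConfig (v - w) := by
  obtain ⟨B, hB⟩ := hv
  obtain ⟨C, hC⟩ := hw
  exact ⟨B + C, fun n => (abs_sub _ _).trans (add_le_add (hB n) (hC n))⟩

theorem abs_act_le (h : LaurentPoly d) {f : (Fin d → ℤ) → ℝ} {C : ℝ} (hf : ∀ n, |f n| ≤ C)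
    (n : Fin d → ℤ) : |h.act f n| ≤ ((∑ j ∈ h.coeff.support, |h.coeff j| : ℤ) : ℝ) * C := by
  push_cast
  rw [Finset.sum_mul]
  refine (Finset.abs_sum_le_sum_abs _ _).trans (Finset.sum_le_sum fun j _ => ?_)
  rw [zsmul_eq_mul, abs_mul]
  have := hf (n - j)
  gcongr

theorem IsSandpile.act_xiBar {h : LaurentPoly d} (hh : h.IsSandpile) {v : (Fin d → ℤ) → ℤ}
    (hv : IsBoundedConfig v) (n : Fin d → ℤ) : h.act (h.xiBar v) n = v n := by
  obtain ⟨C, hC⟩ := hv.exists_abs_le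
  exact congrFun (hh.act_conv hC) n

theorem IsSandpile.xiBar_act {h : LaurentPoly d} (hh : h.IsSandpile) {m : (Fin d → ℤ) → ℤ}
    (hm : IsBoundedConfig m) (n : Fin d → ℤ) : h.xiBar (h.act m) n = m n := by
  obtain ⟨C, hC⟩ := hm.exists_abs_le
  rw [← congrFun (hh.conv_act hC) n]
  simp only [xiBar, conv, act_intCast]

theorem IsSandpile.xiBar_sub {h : LaurentPoly d} (hh : h.IsSandpile) {v w : (Fin d → ℤ) → ℤ}
    (hv : IsBoundedConfig v) (hw : IsBoundedConfig w) (n : Fin d → ℤ) :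
    h.xiBar (v - w) n = h.xiBar v n - h.xiBar w n := by
  unfold xiBar
  rw [← (hh.summable_xiBar hv n).tsum_sub (hh.summable_xiBar hw n)]
  refine tsum_congr fun j => ?_
  push_cast [Pi.sub_apply]
  ring

/-! ### The image of `ξ_h`, and injectivity on finite differences -/

theorem mem_algModel_tilde_iff (h : LaurentPoly d) (x : (Fin d → ℤ) → UnitAddCircle) :
    x ∈ h.tilde.algModel ↔ h.act x = 0 := by
  have key : ∀ m, ∑ n ∈ h.tilde.coeff.support, h.tilde.coeff n • x (n + m) = h.act x m := by
    intro m
    refine Finset.sum_nbij' (fun n => -n) (fun n => -n) ?_ ?_ ?_ ?_ ?_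
    · intro n hn
      simpa [coeff_tilde] using hn
    · intro n hn
      simpa [coeff_tilde] using hn
    · simp
    · simp
    · intro n _
      rw [coeff_tilde, sub_neg_eq_add, add_comm]
  simp only [algModel, Set.mem_ofPred_eq, key, funext_iff, Pi.zero_apply]

theorem IsSandpile.xi_mem {h : LaurentPoly d} (hh : h.IsSandpile) {v : (Fin d → ℤ) → ℤ}
    (hv : IsBoundedConfig v) : h.xi v ∈ h.tilde.algModel := by
  rw [mem_algModel_tilde_iff]
  funext n
  have := h.act_map (QuotientAddGroup.mk' (AddSubgroup.zmultiples (1 : ℝ))) (h.xiBar v) n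
  refine this.trans ?_
  rw [hh.act_xiBar hv]
  exact (AddCircle.coe_eq_zero_iff 1).2 ⟨v n, by simp⟩

theorem IsSandpile.surjOn_xi {h : LaurentPoly d} (hh : h.IsSandpile) :
    Set.SurjOn h.xi h.recurrent h.tilde.algModel := by
  intro x hx
  rw [mem_algModel_tilde_iff] at hx
  have hlift : ∀ n, ∃ y : ℝ, |y| ≤ 1 ∧ (y : UnitAddCircle) = x n := fun n => by
    obtain ⟨y, hy⟩ := QuotientAddGroup.mk_surjective (x n)
    refine ⟨Int.fract y, ?_, ?_⟩
    · rw [abs_of_nonneg (Int.fract_nonneg y)]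
      exact (Int.fract_lt_one y).le
    · rw [← hy, ← sub_eq_zero, ← Int.self_sub_floor]
      exact (AddCircle.coe_sub 1 _ _).symm.trans
        ((AddCircle.coe_eq_zero_iff 1).2 ⟨-⌊y⌋, by simp⟩)
  choose y hy1 hyx using hlift
  -- Since `h · x = 0` modulo 1, the real lift has integral `h · y`.
  have hint : ∀ n, ∃ k : ℤ, (k : ℝ) = h.act y n := fun n => by
    have h1 := h.act_map (QuotientAddGroup.mk' (AddSubgroup.zmultiples (1 : ℝ))) y n
    have h2 : ((h.act y n : ℝ) : UnitAddCircle) = 0 := by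
      refine h1.symm.trans (Eq.trans ?_ (congrFun hx n))
      exact congrArg (fun f => h.act f n) (funext hyx)
    obtain ⟨k, hk⟩ := (AddCircle.coe_eq_zero_iff 1).1 h2
    exact ⟨k, by simpa using hk⟩
  choose v hv using hint
  have hvb : IsBoundedConfig v := by
    refine ⟨∑ j ∈ h.coeff.support, |h.coeff j|, fun n => ?_⟩
    have := h.abs_act_le hy1 n
    rw [← hv, mul_one] at this
    exact_mod_cast this
  obtain ⟨m, hm, hr⟩ := hh.exists_add_act_mem_recurrent hvb
  refine ⟨_, hr, funext fun n => ?_⟩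
  have h1 : h.xiBar v n = y n := by
    rw [← congrFun (hh.conv_act hy1) n]
    simp only [xiBar, conv, hv]
  have h2 := hh.xiBar_sub (isBoundedConfig_of_mem_recurrent hr) hvb n
  rw [add_sub_cancel_left, hh.xiBar_act hm, h1] at h2
  rw [← hyx n, ← sub_eq_zero]
  refine (AddCircle.coe_sub 1 _ _).symm.trans ((AddCircle.coe_eq_zero_iff 1).2 ⟨m n, ?_⟩)
  simp [h2]

theorem IsSandpile.image_xi {h : LaurentPoly d} (hh : h.IsSandpile) :
    h.xi '' h.recurrent = h.tilde.algModel :=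
  Set.Subset.antisymm
    (Set.image_subset_iff.2 fun _ hv => hh.xi_mem (isBoundedConfig_of_mem_recurrent hv)) hh.surjOn_xi

theorem IsSandpile.xi_ne {h : LaurentPoly d} (hh : h.IsSandpile) {v w : (Fin d → ℤ) → ℤ}
    (hv : v ∈ h.recurrent) (hw : w ∈ h.recurrent) (hvw : v ≠ w)
    (hfin : (Function.support (v - w)).Finite) : h.xi v ≠ h.xi w := by
  intro heq
  have hvb := isBoundedConfig_of_mem_recurrent hv
  have hwb := isBoundedConfig_of_mem_recurrent hw
  have hint : ∀ n, ∃ k : ℤ, (k : ℝ) = h.xiBar (v - w) n := fun n => by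
    have h1 : ((h.xiBar (v - w) n : ℝ) : UnitAddCircle) = 0 := by
      rw [hh.xiBar_sub hvb hwb]
      exact (AddCircle.coe_sub 1 _ _).trans (sub_eq_zero.2 (congrFun heq n))
    obtain ⟨k, hk⟩ := (AddCircle.coe_eq_zero_iff 1).1 h1
    exact ⟨k, by simpa using hk⟩
  choose m hm using hint
  have hact : v - w = h.act m := by
    funext n
    have h1 := hh.act_xiBar (hvb.sub hwb) n
    rw [← funext hm, act_intCast] at h1
    exact_mod_cast h1.symm
  -- As `v - w` has finite support, `m` is a finite combination of translates of the homoclinic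
  -- point. Being summable and integral, it vanishes outside a finite set.
  have hsum : Summable fun n => (m n : ℝ) := by
    simp only [hm]
    have key : ∀ n, h.xiBar (v - w) n
        = ∑ k ∈ hfin.toFinset, h.homoclinic (n - k) * ((v - w) k : ℝ) := fun n => by
      unfold xiBar
      rw [← (Equiv.subLeft n).tsum_eq]
      simp only [Equiv.subLeft_apply, sub_sub_cancel]
      refine tsum_eq_sum fun k hk => ?_
      have : (v - w) k = 0 := by simpa using hk
      simp [-Pi.sub_apply, this]
    simp only [key]
    exact summable_sum fun k _ =>
      ((Equiv.subRight k).summable_iff.2 hh.homoclinic_spec.1).mul_right _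
  have hmfin : (Function.support m).Finite := by
    have h1 : ∀ᶠ n in cofinite, |(m n : ℝ)| < 1 := by
      have := hsum.abs.tendsto_cofinite_zero
      exact this.eventually_lt_const one_pos
    refine Set.Finite.subset h1 fun n hn => ?_
    simp only [Set.mem_compl_iff, Set.mem_ofPred_eq, not_lt]
    exact_mod_cast Int.one_le_abs hn
  have hm1 := hh.nonpos_of_sub_eq_act hw hv hmfin hact
  have hm2 := hh.nonpos_of_sub_eq_act (m := -m) hv hw (by rwa [Function.support_neg]) (by
    rw [← neg_sub, hact, ← zero_sub m, act_sub]
    have : h.act (0 : (Fin d → ℤ) → ℤ) = 0 := by funext n; simp [act]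
    rw [this, zero_sub])
  have hm0 : m = 0 := funext fun n => le_antisymm (hm1 n) (by simpa using hm2 n)
  refine hvw (sub_eq_zero.1 ?_)
  rw [hact, hm0]
  funext n
  simp [act]

end LaurentPoly
end

noncomputable section

/-! ### Cubes and entropy -/

theorem mem_cube {d L : ℕ} {n : Fin d → ℤ} : n ∈ cube d L ↔ ∀ i, |n i| ≤ L := by
  simp [cube, Finset.mem_Icc, Pi.le_def, abs_le, forall_and]

theorem card_cube (d L : ℕ) : (cube d L).card = (2 * L + 1) ^ d := by
  have : ((L : ℤ) + 1 + L).toNat = 2 * L + 1 := by omega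
  simp [cube, Pi.card_Icc, this]

theorem exists_subset_cube {d : ℕ} (s : Finset (Fin d → ℤ)) : ∃ K, s ⊆ cube d K := by
  refine ⟨∑ n ∈ s, ∑ i, (n i).natAbs, fun n hn => mem_cube.2 fun i => ?_⟩
  rw [Int.abs_eq_natAbs]
  have h1 := Finset.single_le_sum (f := fun n : Fin d → ℤ => ∑ i, (n i).natAbs)
    (fun _ _ => Nat.zero_le _) hn
  have h2 := Finset.single_le_sum (f := fun i => (n i).natAbs)
    (fun _ _ => Nat.zero_le _) (Finset.mem_univ i)
  exact_mod_cast h2.trans h1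

theorem add_mem_cube {d K L : ℕ} {m n : Fin d → ℤ} (hm : m ∈ cube d K) (hn : n ∈ cube d L) :
    m + n ∈ cube d (K + L) := by
  rw [mem_cube] at *
  intro i
  push_cast
  exact (abs_add_le _ _).trans (add_le_add (hm i) (hn i))

theorem tendsto_card_cube_div (d M : ℕ) :
    Tendsto (fun L : ℕ => ((cube d (L + M)).card : ℝ) / (cube d L).card) atTop (𝓝 1) := by
  have h1 : Tendsto (fun L : ℕ => (2 * M : ℝ) / (2 * L + 1)) atTop (𝓝 0) :=
    tendsto_const_nhds.div_atTop (tendsto_atTop_add_const_right _ _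
      (tendsto_natCast_atTop_atTop.const_mul_atTop two_pos))
  have h2 := (h1.const_add 1).pow d
  simp only [add_zero, one_pow] at h2
  refine h2.congr fun L => ?_
  have : (2 * L + 1 : ℝ) ≠ 0 := by positivity
  rw [card_cube, card_cube]
  push_cast
  rw [← div_pow]
  congr 1
  field_simp
  ring

/-- As `V` contains the diagonal, `φ` is injective on separated sets, so it carries them to
separated sets of the same size. -/
theorem maxSeparated_le {d : ℕ} {Y Z : Type*} {T : (Fin d → ℤ) → Y → Y}
    {S : (Fin d → ℤ) → Z → Z} {Q R : Finset (Fin d → ℤ)} {U : Set (Y × Y)} {V : Set (Z × Z)}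
    (hV : ∀ z, (z, z) ∈ V) (φ : Y → Z)
    (hφ : ∀ x y, (∃ k ∈ Q, (T k x, T k y) ∉ U) → ∃ k ∈ R, (S k (φ x), S k (φ y)) ∉ V) :
    maxSeparated T Q U ≤ maxSeparated S R V := by
  classical
  refine iSup₂_le fun s hs => ?_
  have hinj : Set.InjOn φ s := by
    intro x hx y hy hxy
    by_contra hne
    obtain ⟨k, -, hk⟩ := hφ x y (hs x hx y hy hne)
    exact hk (hxy ▸ hV _)
  rw [← Finset.card_image_of_injOn hinj]
  refine le_iSup₂ (f := fun (t : Finset Z) (_ : IsSeparatedFor S R V t) => (t.card : ℕ∞)) _ ?_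
  intro x hx y hy hne
  obtain ⟨a, ha, rfl⟩ := Finset.mem_image.1 hx
  obtain ⟨b, hb, rfl⟩ := Finset.mem_image.1 hy
  exact hφ a b (hs a ha b hb fun hab => hne (hab ▸ rfl))

theorem one_le_maxSeparated {d : ℕ} {Y : Type*} [Nonempty Y] (T : (Fin d → ℤ) → Y → Y)
    (Q : Finset (Fin d → ℤ)) (U : Set (Y × Y)) : 1 ≤ maxSeparated T Q U := by
  obtain ⟨y⟩ := ‹Nonempty Y›
  have : IsSeparatedFor T Q U {y} := by
    intro a ha b hb hab
    rw [Finset.mem_singleton] at ha hb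
    exact absurd (ha.trans hb.symm) hab
  have h1 := le_iSup₂ (f := fun (t : Finset Y) (_ : IsSeparatedFor T Q U t) => (t.card : ℕ∞))
    {y} this
  rwa [Finset.card_singleton, Nat.cast_one] at h1

/-- Enlarging the cube by a fixed margin is harmless because `|Q_{L+M}| / |Q_L| → 1`. -/
theorem limsup_div_card_cube_le {d : ℕ} (M : ℕ) {a b : ℕ → EReal} (hb : ∀ L, 0 ≤ b L)
    (hab : ∀ L, a L ≤ b (L + M)) :
    limsup (fun L => a L / ((cube d L).card : EReal)) atTop
      ≤ limsup (fun L => b L / ((cube d L).card : EReal)) atTop := by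
  have hpos : ∀ L, 0 < (cube d L).card := fun L => by rw [card_cube]; positivity
  have hpos' : ∀ L, (0 : EReal) < ((cube d L).card : EReal) := fun L => by
    exact_mod_cast hpos L
  have hfin : ∀ L, ((cube d L).card : EReal) ≠ ⊤ := fun L => EReal.natCast_ne_top _
  refine le_of_forall_gt fun t ht => ?_
  obtain ⟨r, hr1, hr2⟩ := EReal.lt_iff_exists_real_btwn.1 ht
  obtain ⟨q, hq1, hq2⟩ := EReal.lt_iff_exists_real_btwn.1 hr2
  have hrq : r < q := by exact_mod_cast hq1
  have hev := eventually_lt_of_limsup_lt hr1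
  have hr0 : 0 ≤ r := by
    obtain ⟨L, hL⟩ := hev.exists
    have : (0 : EReal) < r := (EReal.div_nonneg (hb L) (hpos' L).le).trans_lt hL
    exact_mod_cast this.le
  have hlim : Tendsto (fun L : ℕ => r * (((cube d (L + M)).card : ℝ) / (cube d L).card))
      atTop (𝓝 r) := by
    simpa using (tendsto_card_cube_div d M).const_mul r
  refine lt_of_le_of_lt (limsup_le_of_le (by isBoundedDefault) ?_) hq2
  filter_upwards [(tendsto_add_atTop_nat M).eventually hev, hlim.eventually_lt_const hrq]
    with L h1 h2
  rw [EReal.div_le_iff_le_mul (hpos' L) (hfin L)]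
  rw [EReal.div_lt_iff (hpos' _) (hfin _)] at h1
  refine (hab L).trans (h1.le.trans ?_)
  have h3 : (0 : ℝ) < (cube d L).card := by exact_mod_cast hpos L
  rw [← mul_div_assoc, div_lt_iff₀ h3] at h2
  rw [mul_comm (((cube d L).card : ℕ) : EReal)]
  exact_mod_cast h2.le

theorem latticeEntropy_le {d : ℕ} {Y Z : Type*} [UniformSpace Y] [UniformSpace Z] [Nonempty Z]
    {T : (Fin d → ℤ) → Y → Y} {S : (Fin d → ℤ) → Z → Z}
    (H : ∀ U ∈ 𝓤 Y, ∃ V ∈ 𝓤 Z, ∃ M : ℕ, ∀ L : ℕ,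
      maxSeparated T (cube d L) U ≤ maxSeparated S (cube d (L + M)) V) :
    latticeEntropy T ≤ latticeEntropy S := by
  refine iSup₂_le fun U hU => ?_
  obtain ⟨V, hV, M, hM⟩ := H U hU
  refine le_trans ?_ (le_iSup₂ (f := fun (V : Set (Z × Z)) (_ : V ∈ 𝓤 Z) =>
    limsup (fun L : ℕ => ENNReal.log (maxSeparated S (cube d L) V : ENNReal)
      / ((cube d L).card : EReal)) atTop) V hV)
  refine limsup_div_card_cube_le M (fun L => ?_) fun L => ?_
  · rw [← ENNReal.log_one]
    refine ENNReal.log_monotone ?_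
    exact_mod_cast one_le_maxSeparated S (cube d L) V
  · refine ENNReal.log_monotone ?_
    exact_mod_cast hM L

theorem exists_finset_of_mem_uniformity_pi {ι A : Type*} [UniformSpace A]
    {U : Set ((ι → A) × (ι → A))} (hU : U ∈ 𝓤 (ι → A)) :
    ∃ s : Finset ι, ∀ x y : ι → A, (∀ i ∈ s, x i = y i) → (x, y) ∈ U := by
  rw [Pi.uniformity, Filter.mem_iInf] at hU
  obtain ⟨I, hI, V, hV, rfl⟩ := hU
  refine ⟨hI.toFinset, fun x y hxy => Set.mem_iInter.2 fun i => ?_⟩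
  obtain ⟨W, hW, hWV⟩ := hV i
  refine hWV ?_
  have := hxy i (hI.mem_toFinset.2 i.2)
  simp only [Set.mem_preimage, this]
  exact refl_mem_uniformity hW

namespace LaurentPoly

variable {d : ℕ}

/-! ### The factor map and the first entropy inequality -/

theorem isCompact_recurrent (h : LaurentPoly d) : IsCompact h.recurrent := by
  have hc : IsCompact (Set.univ.pi fun _ : Fin d → ℤ => Set.Icc (0 : ℤ) h.gamma) :=
    isCompact_univ_pi fun _ => isCompact_Icc
  refine hc.of_isClosed_subset ?_ ?_
  · have : h.recurrent = (⋂ n, {v | 0 ≤ v n ∧ v n < h.gamma}) ∩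
        ⋂ (E : Finset (Fin d → ℤ)) (_ : E.Nonempty), ⋃ i ∈ E,
          {v | h.gamma - h.act ((E : Set (Fin d → ℤ)).indicator 1) i ≤ v i} := by
      ext v
      simp [mem_recurrent_iff]
    rw [this]
    refine (isClosed_iInter fun n => ?_).inter
      (isClosed_iInter fun E => isClosed_iInter fun _ => ?_)
    · exact (isClosed_discrete (Set.Ico 0 h.gamma)).preimage
        (continuous_apply (A := fun _ : Fin d → ℤ => ℤ) n)
    · refine Set.Finite.isClosed_biUnion E.finite_toSet fun i _ => ?_
      exact isClosed_le continuous_const (continuous_apply i)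
  · intro v hv n _
    have := ((h.mem_recurrent_iff v).1 hv).1 n
    exact ⟨this.1, this.2.le⟩

/-- The factor map `ξ_h : R^{(h)} → X_{h̃}`. -/
def IsSandpile.xiMap {h : LaurentPoly d} (hh : h.IsSandpile) (v : h.recurrent) :
    h.tilde.algModel :=
  ⟨h.xi v, hh.xi_mem (isBoundedConfig_of_mem_recurrent v.2)⟩

theorem IsSandpile.uniformContinuous_xiMap {h : LaurentPoly d} (hh : h.IsSandpile) :
    UniformContinuous hh.xiMap := by
  have := isCompact_iff_compactSpace.1 h.isCompact_recurrent
  refine CompactSpace.uniformContinuous_of_continuous ?_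
  refine Continuous.subtype_mk (continuous_pi fun n => ?_) _
  refine (AddCircle.continuous_mk' (1 : ℝ)).comp ?_
  refine continuous_tsum (u := fun j => |h.homoclinic j| * h.gamma) (fun j => ?_)
    (hh.homoclinic_spec.1.abs.mul_right _) fun j v => ?_
  · exact continuous_const.mul (continuous_of_discreteTopology.comp
      ((continuous_apply (n - j)).comp continuous_subtype_val))
  · obtain ⟨h0, h1⟩ := ((h.mem_recurrent_iff v.1).1 v.2).1 (n - j)
    rw [Real.norm_eq_abs, abs_mul]
    have : |(v.1 (n - j) : ℝ)| ≤ h.gamma := by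
      rw [← Int.cast_abs, abs_of_nonneg h0]
      exact_mod_cast h1.le
    gcongr

theorem xiBar_latticeShift (h : LaurentPoly d) (k : Fin d → ℤ) (v : (Fin d → ℤ) → ℤ) :
    h.xiBar (latticeShift k v) = latticeShift k (h.xiBar v) := by
  funext n
  simp only [xiBar, latticeShift, sub_add_eq_add_sub]

theorem IsSandpile.xiMap_shift {h : LaurentPoly d} (hh : h.IsSandpile) (k : Fin d → ℤ)
    (v : h.recurrent) : hh.xiMap (h.recurrentShift k v) = h.tilde.algShift k (hh.xiMap v) := by
  refine Subtype.ext (funext fun n => ?_)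
  exact congrArg (fun r : ℝ => (r : UnitAddCircle))
    (congrFun (h.xiBar_latticeShift k v.1) n)

theorem IsSandpile.xiMap_surjective {h : LaurentPoly d} (hh : h.IsSandpile) :
    Function.Surjective hh.xiMap := by
  intro x
  obtain ⟨v, hv, hx⟩ := hh.surjOn_xi x.2
  exact ⟨⟨v, hv⟩, Subtype.ext hx⟩

theorem IsSandpile.nonempty_recurrent {h : LaurentPoly d} (hh : h.IsSandpile) :
    Nonempty h.recurrent := by
  obtain ⟨m, -, hm⟩ := hh.exists_add_act_mem_recurrent (v := 0) ⟨0, by simp⟩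
  exact ⟨⟨_, hm⟩⟩

theorem IsSandpile.latticeEntropy_algShift_le {h : LaurentPoly d} (hh : h.IsSandpile) :
    latticeEntropy h.tilde.algShift ≤ latticeEntropy h.recurrentShift := by
  have := hh.nonempty_recurrent
  refine latticeEntropy_le fun U hU => ?_
  refine ⟨_, hh.uniformContinuous_xiMap hU, 0, fun L => ?_⟩
  -- Any set-theoretic section, continuous or not, lifts separated sets: uniform continuity of `ξ_h`
  -- turns closeness upstairs into closeness downstairs.
  obtain ⟨σ, hσ⟩ := hh.xiMap_surjective.hasRightInverse
  refine maxSeparated_le (fun z => refl_mem_uniformity (hh.uniformContinuous_xiMap hU)) σ ?_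
  rintro x y ⟨k, hk, hxy⟩
  refine ⟨k, hk, fun hmem => hxy ?_⟩
  simpa only [Set.mem_preimage, hh.xiMap_shift, hσ x, hσ y] using hmem

/-! ### Truncation and separation -/

open Classical in
/-- The configuration that agrees with `v` on `s` and is maximal elsewhere. -/
def fillOutside (h : LaurentPoly d) (s : Finset (Fin d → ℤ)) (v : (Fin d → ℤ) → ℤ) :
    (Fin d → ℤ) → ℤ :=
  fun n => if n ∈ s then v n else h.gamma - 1

/-- Recurrence consists of lower bounds besides stability, so it survives raising heights up to `γ_h
- 1`. -/
theorem IsSandpile.fillOutside_mem {h : LaurentPoly d} (hh : h.IsSandpile)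
    (s : Finset (Fin d → ℤ)) {v : (Fin d → ℤ) → ℤ} (hv : v ∈ h.recurrent) :
    h.fillOutside s v ∈ h.recurrent := by
  have hγ := hh.gamma_pos
  rw [mem_recurrent_iff] at hv ⊢
  refine ⟨fun n => ?_, fun E hE => ?_⟩
  · unfold fillOutside
    split_ifs
    · exact hv.1 n
    · exact ⟨by linarith, by linarith⟩
  · obtain ⟨i, hi, hle⟩ := hv.2 E hE
    refine ⟨i, hi, hle.trans ?_⟩
    unfold fillOutside
    split_ifs
    · exact le_rfl
    · linarith [(hv.1 i).2]

/-- Far from the support of `u`, only the tail of the summable homoclinic point contributes. Its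
size is controlled independently of `L`. -/
theorem IsSandpile.exists_tail {h : LaurentPoly d} (hh : h.IsSandpile) {ε : ℝ} (hε : 0 < ε) :
    ∃ K : ℕ, ∀ L : ℕ, ∀ u : (Fin d → ℤ) → ℤ, (∀ n, |u n| ≤ h.gamma) →
      (∀ n ∉ cube d L, u n = 0) → ∀ n ∉ cube d (K + L), |h.xiBar u n| < ε := by
  have hγ : (0 : ℝ) < h.gamma := by exact_mod_cast hh.gamma_pos
  have ha := hh.homoclinic_spec.1.abs
  obtain ⟨s, hs⟩ := ((tendsto_tsum_compl_atTop_zero fun j => |h.homoclinic j|).eventually_lt_const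
    (div_pos hε hγ)).exists
  obtain ⟨K, hK⟩ := exists_subset_cube s
  refine ⟨K, fun L u hu hu0 n hn => ?_⟩
  have hbound : ∀ j, |h.homoclinic j * (u (n - j) : ℝ)|
      ≤ ((s : Set (Fin d → ℤ))ᶜ.indicator (fun j => |h.homoclinic j|) j) * h.gamma := by
    intro j
    by_cases hj : j ∈ s
    · have : u (n - j) = 0 := hu0 _ fun h' => hn (by simpa using add_mem_cube (hK hj) h')
      simp [this, hj]
    · rw [Set.indicator_of_mem (by simpa using hj), abs_mul]
      have : |(u (n - j) : ℝ)| ≤ h.gamma := by exact_mod_cast hu _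
      gcongr
  have hsum : Summable fun j =>
      ((s : Set (Fin d → ℤ))ᶜ.indicator (fun j => |h.homoclinic j|) j) * (h.gamma : ℝ) :=
    (ha.indicator _).mul_right _
  have h1 : |h.xiBar u n| ≤ _ := tsum_of_norm_bounded
    (f := fun j => h.homoclinic j * (u (n - j) : ℝ)) hsum.hasSum hbound
  refine h1.trans_lt ?_
  rw [tsum_mul_right, ← lt_div_iff₀ hγ]
  have h2 := tsum_subtype (s : Set (Fin d → ℤ))ᶜ fun j => |h.homoclinic j|
  rw [← h2]
  exact hs

/-- Points of `X_{h̃}` coming from recurrent configurations that differ only in a cube are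
uniformly separated on a slightly larger cube. -/
theorem IsSandpile.exists_separation {h : LaurentPoly d} (hh : h.IsSandpile) :
    ∃ ε : ℝ, 0 < ε ∧ ∃ K : ℕ, ∀ L : ℕ, ∀ v ∈ h.recurrent, ∀ w ∈ h.recurrent, v ≠ w →
      (∀ n ∉ cube d L, v n = w n) →
      ∃ n ∈ cube d (K + L), ε ≤ dist (h.xi v n) (h.xi w n) := by
  have hγ : (0 : ℝ) < h.gamma := by exact_mod_cast hh.gamma_pos
  -- Lopsidedness, `∑ |h_j| < 2 γ_h`, makes this the right scale: `|e| < 1 / (2 γ_h)` everywhere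
  -- implies `|h · e| < 1`.
  have hε : 0 < 1 / (2 * (h.gamma : ℝ)) := by positivity
  obtain ⟨K, hK⟩ := hh.exists_tail hε
  refine ⟨_, hε, K, fun L v hv w hw hne hvw => ?_⟩
  by_contra! hlt
  have hvb := isBoundedConfig_of_mem_recurrent hv
  have hwb := isBoundedConfig_of_mem_recurrent hw
  have hsupp : (Function.support (v - w)).Finite :=
    (cube d L).finite_toSet.subset fun n hn => by
      by_contra hn'
      exact hn (by simp [hvw n hn'])
  refine hh.xi_ne hv hw hne hsupp ?_
  set y := h.xiBar (v - w) with hy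
  have hdist : ∀ n, dist (h.xi v n) (h.xi w n) = |y n - round (y n)| := fun n => by
    rw [dist_eq_norm, hy, hh.xiBar_sub hvb hwb, ← UnitAddCircle.norm_eq]
    exact congrArg norm (AddCircle.coe_sub 1 _ _).symm
  set e : (Fin d → ℤ) → ℝ := fun n => y n - round (y n) with he
  have hsmall : ∀ n, |e n| < 1 / (2 * (h.gamma : ℝ)) := by
    intro n
    by_cases hn : n ∈ cube d (K + L)
    · rw [he, ← hdist]
      exact hlt n hn
    -- Off the larger cube `y` itself is small, and the nearest integer is at least as close to `y`
    -- as `0` is.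
    · refine lt_of_le_of_lt ?_ (hK L (v - w) (fun k => ?_) (fun k hk => by simp [hvw k hk]) n hn)
      · simpa using round_le (y n) 0
      · obtain ⟨h1, h2⟩ := ((h.mem_recurrent_iff v).1 hv).1 k
        obtain ⟨h3, h4⟩ := ((h.mem_recurrent_iff w).1 hw).1 k
        rw [Pi.sub_apply, abs_le]
        constructor <;> linarith
  -- Both `h · y = v - w` and `h · round(y)` are integral, so `h · e` is an integer of modulus below
  -- 1. Invertibility of `h` on bounded functions then gives `e = 0`, making `y` integral.
  have hact : h.act e = 0 := by
    have hsub : h.act e = h.act y - h.act (fun n => ((round (y n) : ℤ) : ℝ)) := h.act_sub _ _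
    funext n
    have h1 : h.act e n = (((v - w) n - h.act (fun n => round (y n)) n : ℤ) : ℝ) := by
      rw [hsub, Pi.sub_apply, act_intCast, hy, hh.act_xiBar (hvb.sub hwb)]
      push_cast
      rfl
    have h2 := h.abs_act_le (fun n => (hsmall n).le) n
    have h3 : ((∑ j ∈ h.coeff.support, |h.coeff j| : ℤ) : ℝ) * (1 / (2 * (h.gamma : ℝ))) < 1 := by
      rw [mul_one_div, div_lt_one (by positivity)]
      exact_mod_cast hh.lopsided.1
    have h4 := h2.trans_lt h3
    rw [h1] at h4 ⊢
    have h5 : |(v - w) n - h.act (fun n => round (y n)) n| < 1 := by exact_mod_cast h4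
    rw [Int.abs_lt_one_iff.1 h5]
    simp
  have he0 : e = 0 := by
    rw [← hh.conv_act fun n => (hsmall n).le, hact]
    funext n
    simp [conv]
  funext n
  refine dist_eq_zero.1 ?_
  rw [hdist]
  have := congrFun he0 n
  simpa [he] using this

theorem IsSandpile.latticeEntropy_recurrentShift_le {h : LaurentPoly d} (hh : h.IsSandpile) :
    latticeEntropy h.recurrentShift ≤ latticeEntropy h.tilde.algShift := by
  classical
  have : Nonempty h.tilde.algModel := hh.nonempty_recurrent.map hh.xiMap
  obtain ⟨ε, hε, K, hK⟩ := hh.exists_separation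
  refine latticeEntropy_le fun U hU => ?_
  obtain ⟨W, hW, hWU⟩ := hU
  obtain ⟨s, hs⟩ := exists_finset_of_mem_uniformity_pi hW
  obtain ⟨N, hN⟩ := exists_subset_cube s
  have huc : UniformContinuous fun x : h.tilde.algModel => x.1 0 :=
    (Pi.uniformContinuous_proj _ 0).comp uniformContinuous_subtype_val
  refine ⟨_, huc (Metric.dist_mem_uniformity hε), K + N, fun L => ?_⟩
  refine maxSeparated_le (fun z => by simpa using hε)
    -- Truncation makes any two configurations differ finitely, as the separation lemma requires.
    -- The margin `N` retains every coordinate that the entourage `U` sees along the cube.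
    (fun v => hh.xiMap ⟨h.fillOutside (cube d (L + N)) v.1, hh.fillOutside_mem _ v.2⟩) ?_
  rintro v w ⟨k, hk, hvw⟩
  have hne : h.fillOutside (cube d (L + N)) v.1 ≠ h.fillOutside (cube d (L + N)) w.1 := by
    intro heq
    refine hvw (hWU (hs _ _ fun i hi => ?_))
    have hmem : i + k ∈ cube d (L + N) := add_comm k i ▸ add_mem_cube hk (hN hi)
    have h1 := congrFun heq (i + k)
    simp only [fillOutside, hmem, if_true] at h1
    exact h1
  obtain ⟨n, hn, hdist⟩ := hK (L + N) _ (hh.fillOutside_mem _ v.2) _ (hh.fillOutside_mem _ w.2)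
    hne fun n hn => by simp [fillOutside, hn]
  refine ⟨n, ?_, fun hmem => ?_⟩
  · rwa [show L + (K + N) = K + (L + N) by omega]
  · refine absurd hdist (not_le.2 ?_)
    have h1 : dist (h.xi (h.fillOutside (cube d (L + N)) v.1) (0 + n))
        (h.xi (h.fillOutside (cube d (L + N)) w.1) (0 + n)) < ε := hmem
    rwa [zero_add] at h1

end LaurentPoly

end

theorem mainTheorem4 {d : ℕ} (hd : 1 ≤ d) (h : LaurentPoly d) (hh : h.IsSandpile) :
    h.xi '' h.recurrent = h.tilde.algModel ∧
    (∀ v ∈ h.recurrent, ∀ w ∈ h.recurrent, v ≠ w → (Function.support (v - w)).Finite →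
      h.xi v ≠ h.xi w) ∧
    (∀ v : (Fin d → ℤ) → ℤ, LaurentPoly.IsBoundedConfig v →
      ∃ m : (Fin d → ℤ) → ℤ, LaurentPoly.IsBoundedConfig m ∧ v + h.act m ∈ h.recurrent) ∧
    latticeEntropy h.recurrentShift = latticeEntropy h.tilde.algShift :=
  ⟨hh.image_xi, fun _ hv _ hw => hh.xi_ne hv hw, fun _ hv => hh.exists_add_act_mem_recurrent hv,
    hh.latticeEntropy_recurrentShift_le.antisymm hh.latticeEntropy_algShift_le⟩
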